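/- Let $\mathbb T=\mathbb R/2\pi\mathbb Z$. For $f\in L^2(\mathbb T)$ put $\hat f(k)=\frac1{\sqrt{2\pi}}\int_{-\pi}^{\pi}e^{-ikx}f(x)\,dx$ and, for $s\ge 0$, $\|f\|_{H^s}^2=\sum_{k\in\mathbb Z}(1+k^2)^s|\hat f(k)|^2$, and let $H^s(\mathbb T)$ be the space of those $f\in L^2(\mathbb T)$ with $\|f\|_{H^s}<\infty$. For $\varepsilon>0$ let $\phi_\varepsilon(x)=\sum_{n\in\mathbb Z}\frac{1}{2\sqrt{\pi\varepsilon}}e^{-(x-2\pi n)^2/(4\varepsilon)}$ be the periodized heat kernel, let $*$ denote convolution on $\mathbb T$, i.e. $(f*\phi_\varepsilon)(x)=\int_{-\pi}^{\pi}f(y)\phi_\varepsilon(x-y)\,dy$, and let $e^{it\partial_x^2}$ denote the Fourier multiplier with symbol $e^{-itk^2}$. Let $\varepsilon>0$, $\alpha\in[1,2]$, $s\in[1,\infty)$ and a sign $\pm$ be given. Then the Cauchy problem $$ i w_t+\partial_x^2 w\pm\big(|w*\phi_\varepsilon|^{\alpha-1}(w*\phi_\varepsilon)\big)*\phi_\varepsilon=0\quad\text{on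 }\mathbb T\times\mathbb R,\qquad w(\cdot,0)=w_0*\phi_\varepsilon, $$ is globally well-posed in $H^s(\mathbb T)$. That is, calling $w\in C(J,H^s(\mathbb T))$, for an interval $J\ni 0$, a (mild) solution on $J$ with datum $w_0$ if for all $t\in J$ $$ w(\cdot,t)=e^{it\partial_x^2}(w_0*\phi_\varepsilon)\pm i\int_0^t e^{i(t-\tau)\partial_x^2}\Big[\big(|w*\phi_\varepsilon|^{\alpha-1}(w*\phi_\varepsilon)\big)*\phi_\varepsilon(\cdot,\tau)\Big]\,d\tau, $$ the following hold: 1. (existence) for every $w_0\in H^s(\mathbb T)$ there is a solution $w\in C(\mathbb R,H^s(\mathbb T))$ on $\mathbb R$ with datum $w_0$; 2. (uniqueness) for every $w_0\in H^s(\mathbb T)$ and every interval $J\ni0$, any two solutions in $C(J,H^s(\mathbb T))$ on $J$ with datum $w_0$ coincide; 3. (continuous dependence) for every $T>0$, the map sending $w_0\in H^s(\mathbb T)$ to the restriction to $[-T,T]$ of the global solution with datum $w_0$ is continuous from $H^s(\mathbb T)$ to $C([-T,T],H^s(\mathbb T))$ with the supremum norm. -/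

import Mathlib

open MeasureTheory Set Filter Topology
open scoped ENNReal Real

noncomputable section

namespace TorusNLS

instance factTwoPiPos : Fact (0 < 2 * π) := ⟨Real.two_pi_pos⟩

/-- The one-dimensional torus `ℝ / 2πℤ`. -/
abbrev Torus : Type := AddCircle (2 * π)

/-- `L²(𝕋)`. The reference measure is the normalised Haar measure, which is the Lebesgue measure
of `𝕋` divided by `2π`; the space of functions is the same. -/
abbrev L2T : Type := Lp ℂ 2 (AddCircle.haarAddCircle : Measure Torus)

/-- The Fourier coefficient `(2π)^(-1/2) ∫_{-π}^{π} e^{-ikx} f(x) dx`. Mathlib's `fourierCoeff`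
carries the factor `(2π)^(-1)` instead of `(2π)^(-1/2)`. -/
def ft (f : L2T) (k : ℤ) : ℂ := (Real.sqrt (2 * π) : ℂ) * fourierCoeff (f : Torus → ℂ) k

/-- The `H^s(𝕋)` norm `(∑ₖ (1 + k²)^s |f̂(k)|²)^(1/2)`, with the value `∞` if `f ∉ H^s(𝕋)`. -/
def sobolevNorm (s : ℝ) (f : L2T) : ℝ≥0∞ :=
  (∑' k : ℤ, ENNReal.ofReal ((1 + (k : ℝ) ^ 2) ^ s) * ‖ft f k‖ₑ ^ 2) ^ (1 / 2 : ℝ)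

/-- `f ∈ H^s(𝕋)`, for `s ≥ 0`. -/
def MemSobolev (s : ℝ) (f : L2T) : Prop := sobolevNorm s f < ∞

/-- `w ∈ C(J, H^s(𝕋))`. -/
def ContinuousInSobolev (s : ℝ) (J : Set ℝ) (w : ℝ → L2T) : Prop :=
  (∀ t ∈ J, MemSobolev s (w t)) ∧
    ∀ t₀ ∈ J, Tendsto (fun t => sobolevNorm s (w t - w t₀)) (𝓝[J] t₀) (𝓝 0)

/-- The heat kernel on the line, `φ_ε(x) = (2 √(πε))⁻¹ exp(-x² / (4ε))` for `ε > 0`. -/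
def heatKernel (ε x : ℝ) : ℝ := (2 * Real.sqrt (π * ε))⁻¹ * Real.exp (-(x ^ 2) / (4 * ε))

theorem periodic_heatKernel_sum (ε : ℝ) :
    Function.Periodic (fun x : ℝ => ∑' n : ℤ, heatKernel ε (x - 2 * π * n)) (2 * π) := by
  intro x
  beta_reduce
  rw [← (Equiv.addRight (1 : ℤ)).tsum_eq]
  refine tsum_congr fun n => ?_
  congr 1
  simp only [Equiv.coe_addRight]
  push_cast
  ring

/-- The periodised heat kernel `∑ₙ φ_ε(x - 2πn)`, as a function on the torus. -/
def torusHeatKernel (ε : ℝ) : Torus → ℝ := (periodic_heatKernel_sum ε).lift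

/-- The convolution `f ∗ φ_ε` on the torus,
`(f ∗ φ_ε)(x) = ∫_{-π}^{π} f(y) φ_ε(x - y) dy`. -/
def heatConv (ε : ℝ) (f : Torus → ℂ) : Torus → ℂ :=
  convolution f (fun x => (torusHeatKernel ε x : ℂ)) (ContinuousLinearMap.mul ℂ ℂ) volume

/-- `(|w ∗ φ_ε|^(α - 1) (w ∗ φ_ε)) ∗ φ_ε`. -/
def smoothedPower (ε α : ℝ) (w : Torus → ℂ) : Torus → ℂ :=
  heatConv ε fun x => ((‖heatConv ε w x‖ ^ (α - 1) : ℝ) : ℂ) * heatConv ε w x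

open scoped Classical in
/-- The class in `L²(𝕋)` of a square-integrable function. It is only used for the functions in
`memLp_heatConv` and `memLp_smoothedPower` below, which are square-integrable. -/
def toL2 (g : Torus → ℂ) : L2T :=
  if h : MemLp g 2 AddCircle.haarAddCircle then h.toLp g else 0

theorem continuous_torusHeatKernel {ε : ℝ} (hε : 0 < ε) : Continuous (torusHeatKernel ε) := by
  refine continuous_coinduced_dom.mpr ?_
  have hfun : (fun x : ℝ => ∑' n : ℤ, heatKernel ε (x - 2 * π * n)) = fun x : ℝ =>
      (2 * Real.sqrt (π * ε))⁻¹ *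
        HurwitzZeta.evenKernel (((-x / (2 * π) : ℝ)) : UnitAddCircle) (π / ε) := by
    funext x
    have h := HurwitzZeta.hasSum_int_evenKernel (-x / (2 * π)) (div_pos Real.pi_pos hε)
    rw [← (h.mul_left (2 * Real.sqrt (π * ε))⁻¹).tsum_eq]
    refine tsum_congr fun n => ?_
    unfold heatKernel
    congr 2
    have := Real.pi_pos.ne'
    field_simp
    ring
  change Continuous (fun x : ℝ => ∑' n : ℤ, heatKernel ε (x - 2 * π * n))
  rw [hfun]
  refine continuous_const.mul ?_
  have hre : (fun x : ℝ =>
      HurwitzZeta.evenKernel (((-x / (2 * π) : ℝ)) : UnitAddCircle) (π / ε)) =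
      fun x : ℝ => (((HurwitzZeta.evenKernel (((-x / (2 * π) : ℝ)) : UnitAddCircle) (π / ε) : ℝ)
        : ℂ)).re := by
    funext x; simp
  rw [hre]
  refine Complex.continuous_re.comp ?_
  simp only [HurwitzZeta.evenKernel_def]
  have hτ : 0 < (Complex.I * ((π / ε : ℝ) : ℂ)).im := by
    simpa using div_pos Real.pi_pos hε
  refine Continuous.mul (by fun_prop) (continuous_iff_continuousAt.mpr fun x => ?_)
  exact ContinuousAt.comp (g := fun z => jacobiTheta₂ z (Complex.I * ((π / ε : ℝ) : ℂ)))
    (differentiableAt_jacobiTheta₂_fst _ hτ).continuousAt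
    (Continuous.continuousAt (by fun_prop))

theorem continuous_heatConv {ε : ℝ} (hε : 0 < ε) {f : Torus → ℂ}
    (hf : Integrable f AddCircle.haarAddCircle) : Continuous (heatConv ε f) := by
  have hc : Continuous fun x => (torusHeatKernel ε x : ℂ) :=
    Complex.continuous_ofReal.comp (continuous_torusHeatKernel hε)
  have hi : Integrable f (volume : Measure Torus) := by
    rw [AddCircle.volume_eq_smul_haarAddCircle]
    exact hf.smul_measure ENNReal.ofReal_ne_top
  exact BddAbove.continuous_convolution_right_of_integrable (ContinuousLinearMap.mul ℂ ℂ)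
    (isCompact_range hc.norm).bddAbove hi hc

theorem memLp_of_continuous {g : Torus → ℂ} (hg : Continuous g) :
    MemLp g 2 (AddCircle.haarAddCircle : Measure Torus) :=
  hg.memLp_of_hasCompactSupport (HasCompactSupport.of_compactSpace g)

theorem memLp_heatConv {ε : ℝ} (hε : 0 < ε) (w : L2T) :
    MemLp (heatConv ε w) 2 (AddCircle.haarAddCircle : Measure Torus) :=
  memLp_of_continuous (continuous_heatConv hε ((Lp.memLp w).integrable (by norm_num)))

theorem memLp_smoothedPower {ε α : ℝ} (hε : 0 < ε) (hα : 1 ≤ α) (w : L2T) :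
    MemLp (smoothedPower ε α w) 2 (AddCircle.haarAddCircle : Measure Torus) := by
  have h := continuous_heatConv hε ((Lp.memLp w).integrable (by norm_num))
  refine memLp_of_continuous (continuous_heatConv hε ((memLp_of_continuous ?_).integrable
    (by norm_num)))
  exact (Complex.continuous_ofReal.comp
    (h.norm.rpow_const fun _ => Or.inr (by linarith))).mul h

/-- The Schrödinger group `e^{it∂ₓ²}` on `L²(𝕋)`, the Fourier multiplier with symbol `e^{-itk²}`.
The series converges in `L²(𝕋)`. -/
def schrodinger (t : ℝ) (f : L2T) : L2T :=
  ∑' k : ℤ, (Complex.exp (-Complex.I * t * (k : ℂ) ^ 2) * fourierCoeff (f : Torus → ℂ) k) •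
    fourierLp 2 k

/-- `w` satisfies on `J` the Duhamel formula (it is a mild solution) of
`i w_t + w_xx + σ (|w ∗ φ_ε|^(α-1) (w ∗ φ_ε)) ∗ φ_ε = 0`, `w(0) = w₀ ∗ φ_ε`.
The integral is the Bochner integral in `L²(𝕋)`. -/
def IsMildSolution (ε α σ : ℝ) (w₀ : L2T) (J : Set ℝ) (w : ℝ → L2T) : Prop :=
  ∀ t ∈ J, w t = schrodinger t (toL2 (heatConv ε w₀)) +
    ((σ : ℂ) * Complex.I) •
      ∫ τ in (0 : ℝ)..t, schrodinger (t - τ) (toL2 (smoothedPower ε α (w τ)))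

/-- `w ∈ C(J, H^s(𝕋))` is a mild solution on `J` with datum `w₀`. -/
def IsSobolevSolution (ε α σ s : ℝ) (w₀ : L2T) (J : Set ℝ) (w : ℝ → L2T) : Prop :=
  ContinuousInSobolev s J w ∧ IsMildSolution ε α σ w₀ J w

/-- Global well-posedness in `H^s(𝕋)` of the smoothed equation: existence of a solution in
`C(ℝ, H^s(𝕋))`, uniqueness in `C(J, H^s(𝕋))` on every interval `J` containing the initial time,
and continuity of the map from the datum in `H^s(𝕋)` to the solution in `C([-T, T], H^s(𝕋))`
for every `T`. -/
structure GloballyWellPosed (ε α σ s : ℝ) : Prop where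
  exists_solution : ∀ w₀ : L2T, MemSobolev s w₀ →
    ∃ w : ℝ → L2T, IsSobolevSolution ε α σ s w₀ univ w
  unique : ∀ w₀ : L2T, MemSobolev s w₀ → ∀ J : Set ℝ, J.OrdConnected → (0 : ℝ) ∈ J →
    ∀ w w' : ℝ → L2T, IsSobolevSolution ε α σ s w₀ J w → IsSobolevSolution ε α σ s w₀ J w' →
      EqOn w w' J
  continuous_dependence : ∀ w₀ : L2T, MemSobolev s w₀ →
    ∀ w : ℝ → L2T, IsSobolevSolution ε α σ s w₀ univ w →
    ∀ T : ℝ, 0 < T → ∀ η : ℝ≥0∞, 0 < η → ∃ δ : ℝ≥0∞, 0 < δ ∧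
      ∀ w₀' : L2T, MemSobolev s w₀' → sobolevNorm s (w₀' - w₀) < δ →
        ∀ w' : ℝ → L2T, IsSobolevSolution ε α σ s w₀' univ w' →
          ∀ t ∈ Icc (-T) T, sobolevNorm s (w' t - w t) < η

end TorusNLS

end

/-! Convolution with `φ_ε` is the Fourier multiplier `e^{-εk²}`: it is self-adjoint, contracts
`L²(𝕋)`, and maps `L²` boundedly into bounded functions and into every `H^s`. The nonlinearity
therefore loses no derivatives, and the problem is an ODE in `L²`.

In the interaction picture `u(t) = e^{-it∂ₓ²} w(t)` the unbounded operator disappears. The resulting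
field is Lipschitz on balls uniformly in time (`exists_lipschitzOnWith_interactionField`). It is
also orthogonal to `u` in the real inner product, because `⟨w, (|w∗φ_ε|^(α-1)(w∗φ_ε))∗φ_ε⟩ = ∫
|w∗φ_ε|^(α+1)` is real and is multiplied by `iσ` with `σ` real (`inner_interactionField_re`). So the
`L²` norm is conserved, which makes solutions global (`exists_trajectory_of_orthogonal`); Grönwall's
inequality gives uniqueness and Lipschitz dependence in `L²` (`IsMildSolution.norm_sub_le`).

No `H^s` estimate of the nonlinearity is needed. Both terms of the Duhamel formula end with a heat
convolution, so `w(t)` is the heat operator applied to an `L²`-continuous profile, `preheat`. The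
bound `exists_sobolevNorm_heatCLM_le` turns `L²` continuity of the profile, in time and in the
datum, into `H^s` continuity of `w`. -/

open scoped NNReal

noncomputable section

namespace TorusNLS

/-! ### Global flows of norm-preserving vector fields -/

section ODE

variable {E : Type*} [NormedAddCommGroup E]

section NormedSpace

variable [NormedSpace ℝ E]

/-- Two trajectories of a vector field that is `K`-Lipschitz on `s` diverge at most exponentially,
forwards and backwards in time. -/
theorem norm_sub_le_of_trajectories {F : ℝ → E → E} {K : ℝ≥0} {s : Set E} {b : ℝ} {u v : ℝ → E}
    (hF : ∀ t, LipschitzOnWith K (F t) s)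
    (hu : ∀ t ∈ uIcc 0 b, HasDerivAt u (F t (u t)) t)
    (hv : ∀ t ∈ uIcc 0 b, HasDerivAt v (F t (v t)) t)
    (hus : ∀ t ∈ uIcc 0 b, u t ∈ s) (hvs : ∀ t ∈ uIcc 0 b, v t ∈ s) :
    ‖u b - v b‖ ≤ ‖u 0 - v 0‖ * Real.exp (K * |b|) := by
  rcases le_total 0 b with hb | hb
  · rw [uIcc_of_le hb] at hu hv hus hvs
    have := dist_le_of_trajectories_ODE_of_mem (v := F) (s := fun _ => s) (K := K) (f := u) (g := v)
      (a := 0) (b := b) (fun t _ => hF t) (fun t ht => (hu t ht).continuousAt.continuousWithinAt)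
      (fun t ht => (hu t (Ico_subset_Icc_self ht)).hasDerivWithinAt)
      (fun t ht => hus t (Ico_subset_Icc_self ht))
      (fun t ht => (hv t ht).continuousAt.continuousWithinAt)
      (fun t ht => (hv t (Ico_subset_Icc_self ht)).hasDerivWithinAt)
      (fun t ht => hvs t (Ico_subset_Icc_self ht)) le_rfl b (right_mem_Icc.2 hb)
    simpa [dist_eq_norm, abs_of_nonneg hb] using this
  · rw [uIcc_of_ge hb] at hu hv hus hvs
    -- Time reversal: `r ↦ u (-r)` follows the field `-F (-r)`, which has the same Lipschitz
    -- constant.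
    have hmem : ∀ {t : ℝ}, t ∈ Icc 0 (-b) → -t ∈ Icc b 0 := fun {t} ht =>
      ⟨by linarith [ht.2], by linarith [ht.1]⟩
    have hderiv : ∀ {w : ℝ → E}, (∀ t ∈ Icc b 0, HasDerivAt w (F t (w t)) t) →
        ∀ t ∈ Icc 0 (-b), HasDerivAt (fun r => w (-r)) (-F (-t) (w (-t))) t := by
      intro w hw t ht
      simpa [Function.comp_def] using (hw (-t) (hmem ht)).scomp t (hasDerivAt_neg t)
    have := dist_le_of_trajectories_ODE_of_mem (v := fun t x => -F (-t) x) (s := fun _ => s)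
      (K := K) (f := fun r => u (-r)) (g := fun r => v (-r))
      (a := 0) (b := -b) (fun t _ => (hF (-t)).neg)
      (fun t ht => (hderiv hu t ht).continuousAt.continuousWithinAt)
      (fun t ht => (hderiv hu t (Ico_subset_Icc_self ht)).hasDerivWithinAt)
      (fun t ht => hus _ (hmem (Ico_subset_Icc_self ht)))
      (fun t ht => (hderiv hv t ht).continuousAt.continuousWithinAt)
      (fun t ht => (hderiv hv t (Ico_subset_Icc_self ht)).hasDerivWithinAt)
      (fun t ht => hvs _ (hmem (Ico_subset_Icc_self ht))) le_rfl (-b) ⟨by linarith, le_rfl⟩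
    simpa [dist_eq_norm, abs_of_nonpos hb] using this

/-- A bounded and globally Lipschitz vector field has global trajectories. -/
theorem exists_trajectory_of_bounded_of_lipschitz [CompleteSpace E] {F : ℝ → E → E} {K L : ℝ≥0}
    (hF : ∀ t, LipschitzWith K (F t)) (hL : ∀ t x, ‖F t x‖ ≤ L)
    (hc : ∀ x, Continuous fun t => F t x) (x₀ : E) :
    ∃ u : ℝ → E, u 0 = x₀ ∧ ∀ t, HasDerivAt u (F t (u t)) t := by
  have hloc : ∀ n : ℕ, ∃ u : ℝ → E, u 0 = x₀ ∧
      ∀ t : ℝ, |t| < n + 1 → HasDerivAt u (F t (u t)) t := by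
    intro n
    have hn : (0 : ℝ) ≤ n + 1 := by positivity
    -- With speed at most `L`, a trajectory stays within `L * (n + 1)` of `x₀` up to time `n + 1`,
    -- so a ball of this radius imposes no restriction on the existence time.
    have hPL : IsPicardLindelof F (tmin := -(n + 1)) (tmax := n + 1)
        ⟨0, by constructor <;> linarith⟩ x₀ (L * (n + 1)) 0 L K :=
      { lipschitzOnWith := fun t _ => (hF t).lipschitzOnWith
        continuousOn := fun x _ => (hc x).continuousOn
        norm_le := fun t _ x _ => hL t x
        mul_max_le := by simp }
    obtain ⟨u, hu0, hu⟩ := hPL.exists_eq_forall_mem_Icc_hasDerivWithinAt₀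
    refine ⟨u, hu0, fun t ht => ?_⟩
    have ht' := abs_lt.1 ht
    exact (hu t ⟨ht'.1.le, ht'.2.le⟩).hasDerivAt (Icc_mem_nhds ht'.1 ht'.2)
  choose u hu0 hu using hloc
  have hagree : ∀ (m n : ℕ) (t : ℝ), |t| < m + 1 → |t| < n + 1 → u m t = u n t := by
    intro m n t hm hn
    have habs : ∀ r ∈ uIcc 0 t, |r| ≤ |t| := fun r hr => by
      simpa using abs_sub_left_of_mem_uIcc hr
    have := norm_sub_le_of_trajectories (s := univ) (b := t) (fun t => (hF t).lipschitzOnWith)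
      (fun r hr => hu m r ((habs r hr).trans_lt hm)) (fun r hr => hu n r ((habs r hr).trans_lt hn))
      (fun _ _ => mem_univ _) (fun _ _ => mem_univ _)
    rw [hu0, hu0, sub_self, norm_zero, zero_mul] at this
    exact sub_eq_zero.1 (norm_le_zero_iff.1 this)
  refine ⟨fun t => u ⌈|t|⌉₊ t, hu0 _, fun t => ?_⟩
  have hlt : ∀ r : ℝ, |r| < (⌈|r|⌉₊ : ℝ) + 1 := fun r => (Nat.le_ceil _).trans_lt (by linarith)
  have hev : (fun r => u ⌈|r|⌉₊ r) =ᶠ[𝓝 t] u ⌈|t|⌉₊ := by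
    filter_upwards [continuous_abs.continuousAt.eventually_lt_const (hlt t)] with r hr
    exact hagree _ _ r (hlt r) hr
  exact (hu _ t (hlt t)).congr_of_eventuallyEq hev

/-- The radial retraction onto the closed ball of radius `R`. -/
def radialRetraction (R : ℝ) (x : E) : E := (R / max R ‖x‖) • x

theorem radialRetraction_of_norm_le {R : ℝ} (hR : 0 < R) {x : E} (hx : ‖x‖ ≤ R) :
    radialRetraction R x = x := by
  rw [radialRetraction, max_eq_left hx, div_self hR.ne', one_smul]

theorem norm_radialRetraction_le {R : ℝ} (hR : 0 < R) (x : E) : ‖radialRetraction R x‖ ≤ R := by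
  have hm : 0 < max R ‖x‖ := lt_max_of_lt_left hR
  rw [radialRetraction, norm_smul, Real.norm_of_nonneg (by positivity), div_mul_eq_mul_div,
    div_le_iff₀ hm]
  gcongr
  exact le_max_right _ _

/-- Changing the vector and changing the scaling factor each cost at most `‖x - y‖`; this gives the
constant 2, valid in any normed space. -/
theorem lipschitzWith_radialRetraction {R : ℝ} (hR : 0 < R) :
    LipschitzWith 2 (radialRetraction R : E → E) := by
  refine LipschitzWith.of_dist_le_mul fun x y => ?_
  rw [dist_eq_norm, dist_eq_norm]
  have hx : 0 < max R ‖x‖ := lt_max_of_lt_left hR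
  have hy : 0 < max R ‖y‖ := lt_max_of_lt_left hR
  have hsplit : radialRetraction R x - radialRetraction R y =
      (R / max R ‖x‖) • (x - y) + (R / max R ‖x‖ - R / max R ‖y‖) • y := by
    simp only [radialRetraction, smul_sub, sub_smul]; abel
  have h1 : ‖(R / max R ‖x‖) • (x - y)‖ ≤ ‖x - y‖ := by
    rw [norm_smul, Real.norm_of_nonneg (by positivity)]
    exact mul_le_of_le_one_left (norm_nonneg _) ((div_le_one hx).2 (le_max_left _ _))
  have h2 : ‖(R / max R ‖x‖ - R / max R ‖y‖) • y‖ ≤ ‖x - y‖ := by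
    have hd : R / max R ‖x‖ - R / max R ‖y‖ =
        (R / max R ‖x‖) * ((max R ‖y‖ - max R ‖x‖) / max R ‖y‖) := by
      field_simp
    have hab : |max R ‖y‖ - max R ‖x‖| ≤ ‖x - y‖ := by
      have := abs_max_sub_max_le_abs ‖y‖ ‖x‖ R
      rw [max_comm R, max_comm R, norm_sub_rev]
      exact this.trans (abs_norm_sub_norm_le y x)
    rw [norm_smul, hd, norm_mul, Real.norm_of_nonneg (show 0 ≤ R / max R ‖x‖ by positivity),
      norm_div, Real.norm_eq_abs, Real.norm_of_nonneg hy.le]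
    calc R / max R ‖x‖ * (|max R ‖y‖ - max R ‖x‖| / max R ‖y‖) * ‖y‖
        = (R / max R ‖x‖) * (‖y‖ / max R ‖y‖) * |max R ‖y‖ - max R ‖x‖| := by ring
      _ ≤ 1 * 1 * ‖x - y‖ := by
        gcongr
        · exact (div_le_one hx).2 (le_max_left _ _)
        · exact (div_le_one hy).2 (le_max_right _ _)
      _ = ‖x - y‖ := by ring
  rw [hsplit]
  refine (norm_add_le _ _).trans ?_
  simp only [NNReal.coe_ofNat]
  linarith

end NormedSpace

section InnerProductSpace

variable [InnerProductSpace ℂ E]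

/-- The norm is constant along a curve whose velocity is orthogonal to its position. -/
theorem norm_eq_of_inner_deriv_re_eq_zero {u u' : ℝ → E} {b : ℝ}
    (hu : ∀ t ∈ uIcc 0 b, HasDerivAt u (u' t) t)
    (horth : ∀ t ∈ uIcc 0 b, (inner ℂ (u t) (u' t)).re = 0) : ‖u b‖ = ‖u 0‖ := by
  have hd : ∀ t ∈ uIcc 0 b, HasDerivWithinAt (fun r => inner ℂ (u r) (u r)) 0 (uIcc 0 b) t := by
    intro t ht
    have h := (hu t ht).inner ℂ (hu t ht)
    have h0 : inner ℂ (u t) (u' t) + inner ℂ (u' t) (u t) = 0 := by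
      rw [← inner_conj_symm (u' t) (u t), Complex.add_conj, horth t ht]
      simp
    rw [h0] at h
    exact h.hasDerivWithinAt
  have hle := (convex_uIcc 0 b).norm_image_sub_le_of_norm_hasDerivWithin_le (C := 0) hd
    (fun _ _ => by simp) left_mem_uIcc right_mem_uIcc
  have heq : inner ℂ (u b) (u b) = inner ℂ (u 0) (u 0) := by
    rw [zero_mul] at hle
    exact sub_eq_zero.1 (norm_le_zero_iff.1 hle)
  rw [inner_self_eq_norm_sq_to_K, inner_self_eq_norm_sq_to_K] at heq
  have : ‖u b‖ ^ 2 = ‖u 0‖ ^ 2 := by exact_mod_cast heq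
  exact (sq_eq_sq₀ (norm_nonneg _) (norm_nonneg _)).1 this

/-- A locally Lipschitz vector field that is orthogonal to the position vector has global
trajectories. -/
theorem exists_trajectory_of_orthogonal [CompleteSpace E] {F : ℝ → E → E}
    (hF : ∀ R : ℝ, ∃ K : ℝ≥0, ∀ t, LipschitzOnWith K (F t) (Metric.closedBall 0 R))
    (h0 : ∀ t, F t 0 = 0) (hc : ∀ x, Continuous fun t => F t x)
    (horth : ∀ t x, (inner ℂ x (F t x)).re = 0) (x₀ : E) :
    ∃ u : ℝ → E, u 0 = x₀ ∧ ∀ t, HasDerivAt u (F t (u t)) t := by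
  -- The added 1 keeps the radius positive when `x₀ = 0`.
  set R : ℝ := ‖x₀‖ + 1
  have hR : 0 < R := by positivity
  obtain ⟨K, hK⟩ := hF R
  have hmem : ∀ x : E, radialRetraction R x ∈ Metric.closedBall (0 : E) R := fun x => by
    simpa using norm_radialRetraction_le hR x
  -- Composing with the retraction makes the field globally Lipschitz, and bounded by `K * R`
  -- because it vanishes at 0.
  obtain ⟨u, hu0, hu⟩ := exists_trajectory_of_bounded_of_lipschitz
    (F := fun t x => F t (radialRetraction R x)) (K := K * 2) (L := K * R.toNNReal)
    (fun t => by
      have h := (hK t).comp ((lipschitzWith_radialRetraction (E := E) hR).lipschitzOnWith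
        (s := univ)) (fun x _ => hmem x)
      exact lipschitzOnWith_univ.1 h)
    (fun t x => by
      have h := (hK t).dist_le_mul _ (hmem x) 0 (by simpa using hR.le)
      rw [h0, dist_zero_right, dist_zero_right] at h
      rw [NNReal.coe_mul, Real.coe_toNNReal _ hR.le]
      exact h.trans (by gcongr; exact norm_radialRetraction_le hR x))
    (fun x => hc _) x₀
  -- The retraction of `x` is a positive real multiple of `x`, so the truncated field is still
  -- orthogonal to the position. The trajectory then never leaves the ball, where the truncation
  -- does nothing.
  have hnorm : ∀ t, ‖u t‖ = ‖u 0‖ := by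
    intro t
    refine norm_eq_of_inner_deriv_re_eq_zero (fun r _ => hu r) (fun r _ => ?_)
    have hm : 0 < max R ‖u r‖ := lt_max_of_lt_left hR
    have h := horth r (radialRetraction R (u r))
    nth_rw 1 [radialRetraction] at h
    rw [RCLike.real_smul_eq_coe_smul (K := ℂ), inner_smul_left] at h
    simpa [hR.ne', hm.ne'] using h
  refine ⟨u, hu0, fun t => ?_⟩
  have h := hu t
  rwa [radialRetraction_of_norm_le hR (by rw [hnorm, hu0]; simp [R])] at h

end InnerProductSpace

end ODE

/-! ### Fourier multipliers with symbol bounded by one -/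

section FourierMultiplier

theorem fourierCoeff_eq_repr (f : L2T) (k : ℤ) :
    fourierCoeff (f : Torus → ℂ) k = fourierBasis.repr f k :=
  (fourierBasis_repr f k).symm

theorem L2T.ext_fourierCoeff {f g : L2T}
    (h : ∀ k, fourierCoeff (f : Torus → ℂ) k = fourierCoeff (g : Torus → ℂ) k) : f = g := by
  refine fourierBasis.repr.injective (lp.ext (funext fun k => ?_))
  rw [← fourierCoeff_eq_repr, ← fourierCoeff_eq_repr, h]

theorem fourierCoeff_add_L2T (f g : L2T) (k : ℤ) : fourierCoeff (↑(f + g) : Torus → ℂ) k =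
    fourierCoeff (f : Torus → ℂ) k + fourierCoeff (g : Torus → ℂ) k := by
  rw [fourierCoeff_eq_repr, fourierCoeff_eq_repr, fourierCoeff_eq_repr, map_add]
  rfl

theorem fourierCoeff_sub_L2T (f g : L2T) (k : ℤ) : fourierCoeff (↑(f - g) : Torus → ℂ) k =
    fourierCoeff (f : Torus → ℂ) k - fourierCoeff (g : Torus → ℂ) k := by
  rw [fourierCoeff_eq_repr, fourierCoeff_eq_repr, fourierCoeff_eq_repr, map_sub]
  rfl

theorem hasSum_sq_norm_fourierCoeff (f : L2T) :
    HasSum (fun k : ℤ => ‖fourierCoeff (f : Torus → ℂ) k‖ ^ 2) (‖f‖ ^ 2) := by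
  have h := lp.hasSum_norm (p := 2) (by norm_num) (fourierBasis.repr f)
  simpa [fourierCoeff_eq_repr] using h

theorem norm_fourierCoeff_le (f : L2T) (k : ℤ) : ‖fourierCoeff (f : Torus → ℂ) k‖ ≤ ‖f‖ := by
  have h := le_hasSum (hasSum_sq_norm_fourierCoeff f) k fun _ _ => by positivity
  exact (sq_le_sq₀ (norm_nonneg _) (norm_nonneg _)).1 h

theorem tsum_sq_enorm_fourierCoeff (f : L2T) :
    ∑' k : ℤ, ‖fourierCoeff (f : Torus → ℂ) k‖ₑ ^ 2 = ‖f‖ₑ ^ 2 := by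
  have h := hasSum_sq_norm_fourierCoeff f
  simp only [← ofReal_norm, ← ENNReal.ofReal_pow (norm_nonneg _)]
  rw [← h.tsum_eq, ENNReal.ofReal_tsum_of_nonneg (fun _ => by positivity) h.summable]

theorem memℓp_mul_fourierCoeff {m : ℤ → ℂ} (hm : ∀ k, ‖m k‖ ≤ 1) (f : L2T) :
    Memℓp (fun k => m k * fourierCoeff (f : Torus → ℂ) k) 2 := by
  refine memℓp_gen ?_
  simp only [ENNReal.toReal_ofNat, Real.rpow_ofNat]
  refine (hasSum_sq_norm_fourierCoeff f).summable.of_nonneg_of_le (fun _ => by positivity)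
    fun k => ?_
  rw [norm_mul, mul_pow]
  exact mul_le_of_le_one_left (by positivity) (pow_le_one₀ (norm_nonneg _) (hm k))

/-- The function whose Fourier coefficients are those of `f` multiplied by the symbol `m`. -/
def multiplierFun {m : ℤ → ℂ} (hm : ∀ k, ‖m k‖ ≤ 1) (f : L2T) : L2T :=
  fourierBasis.repr.symm ⟨_, memℓp_mul_fourierCoeff hm f⟩

theorem fourierCoeff_multiplierFun {m : ℤ → ℂ} (hm : ∀ k, ‖m k‖ ≤ 1) (f : L2T) (k : ℤ) :
    fourierCoeff (multiplierFun hm f : Torus → ℂ) k = m k * fourierCoeff (f : Torus → ℂ) k := by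
  rw [fourierCoeff_eq_repr, multiplierFun, LinearIsometryEquiv.apply_symm_apply]

theorem norm_multiplierFun_le {m : ℤ → ℂ} (hm : ∀ k, ‖m k‖ ≤ 1) (f : L2T) :
    ‖multiplierFun hm f‖ ≤ ‖f‖ := by
  refine (sq_le_sq₀ (norm_nonneg _) (norm_nonneg _)).1 ?_
  refine hasSum_le (fun k => ?_) (hasSum_sq_norm_fourierCoeff _) (hasSum_sq_norm_fourierCoeff f)
  rw [fourierCoeff_multiplierFun, norm_mul, mul_pow]
  exact mul_le_of_le_one_left (by positivity) (pow_le_one₀ (norm_nonneg _) (hm k))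

/-- The Fourier multiplier on `L²(𝕋)` with a symbol `m` bounded by one. -/
def multiplier (m : ℤ → ℂ) (hm : ∀ k, ‖m k‖ ≤ 1) : L2T →L[ℂ] L2T :=
  LinearMap.mkContinuous
    { toFun := multiplierFun hm
      map_add' := fun f g => L2T.ext_fourierCoeff fun k => by
        simp only [fourierCoeff_add_L2T, fourierCoeff_multiplierFun, mul_add]
      map_smul' := fun c f => L2T.ext_fourierCoeff fun k => by
        have hs : ∀ g : L2T, fourierCoeff (↑(c • g) : Torus → ℂ) k =
            c * fourierCoeff (g : Torus → ℂ) k := fun g => by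
          simp [fourierCoeff_eq_repr]
        simp only [hs, fourierCoeff_multiplierFun, RingHom.id_apply]
        ring } 1 fun f => by
      rw [one_mul]
      exact norm_multiplierFun_le hm f

variable {m m' : ℤ → ℂ} {hm : ∀ k, ‖m k‖ ≤ 1} {hm' : ∀ k, ‖m' k‖ ≤ 1}

theorem fourierCoeff_multiplier (f : L2T) (k : ℤ) :
    fourierCoeff (multiplier m hm f : Torus → ℂ) k = m k * fourierCoeff (f : Torus → ℂ) k :=
  fourierCoeff_multiplierFun hm f k

theorem norm_multiplier_le (f : L2T) : ‖multiplier m hm f‖ ≤ ‖f‖ :=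
  norm_multiplierFun_le hm f

theorem multiplier_comm (f : L2T) :
    multiplier m hm (multiplier m' hm' f) = multiplier m' hm' (multiplier m hm f) :=
  L2T.ext_fourierCoeff fun k => by
    simp only [fourierCoeff_multiplier]
    ring

theorem hasSum_multiplier (f : L2T) :
    HasSum (fun k => (m k * fourierCoeff (f : Torus → ℂ) k) • fourierLp 2 k)
      (multiplier m hm f) := by
  have h := hasSum_fourier_series_L2 (multiplier m hm f)
  simpa only [fourierCoeff_multiplier] using h

theorem inner_multiplier_left (h : ∀ k, (starRingEnd ℂ) (m k) = m' k) (f g : L2T) :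
    inner ℂ (multiplier m hm f) g = inner ℂ f (multiplier m' hm' g) := by
  rw [← fourierBasis.repr.inner_map_map, ← fourierBasis.repr.inner_map_map f,
    lp.inner_eq_tsum, lp.inner_eq_tsum]
  refine tsum_congr fun k => ?_
  simp only [← fourierCoeff_eq_repr, fourierCoeff_multiplier, RCLike.inner_apply, map_mul, h]
  ring

end FourierMultiplier

/-! ### The Schrödinger group as a strongly continuous unitary group -/

section Schrodinger

theorem norm_exp_neg_I_mul (t : ℝ) (k : ℤ) :
    ‖Complex.exp (-Complex.I * t * (k : ℂ) ^ 2)‖ = 1 := by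
  have h : -Complex.I * t * (k : ℂ) ^ 2 = ((-(t * (k : ℝ) ^ 2) : ℝ) : ℂ) * Complex.I := by
    push_cast; ring
  rw [h, Complex.norm_exp_ofReal_mul_I]

/-- The Schrödinger group as a family of continuous linear maps. -/
def schrodingerCLM (t : ℝ) : L2T →L[ℂ] L2T :=
  multiplier (fun k => Complex.exp (-Complex.I * t * (k : ℂ) ^ 2))
    fun k => (norm_exp_neg_I_mul t k).le

theorem schrodinger_eq (t : ℝ) (f : L2T) : schrodinger t f = schrodingerCLM t f :=
  (hasSum_multiplier f).tsum_eq

theorem fourierCoeff_schrodingerCLM (t : ℝ) (f : L2T) (k : ℤ) :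
    fourierCoeff (schrodingerCLM t f : Torus → ℂ) k =
      Complex.exp (-Complex.I * t * (k : ℂ) ^ 2) * fourierCoeff (f : Torus → ℂ) k :=
  fourierCoeff_multiplier f k

theorem schrodingerCLM_schrodingerCLM (t r : ℝ) (f : L2T) :
    schrodingerCLM t (schrodingerCLM r f) = schrodingerCLM (t + r) f :=
  L2T.ext_fourierCoeff fun k => by
    simp only [fourierCoeff_schrodingerCLM]
    rw [← mul_assoc, ← Complex.exp_add]
    congr 2
    push_cast
    ring

theorem schrodingerCLM_zero (f : L2T) : schrodingerCLM 0 f = f :=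
  L2T.ext_fourierCoeff fun k => by simp [fourierCoeff_schrodingerCLM]

theorem norm_schrodingerCLM (t : ℝ) (f : L2T) : ‖schrodingerCLM t f‖ = ‖f‖ := by
  refine le_antisymm (norm_multiplier_le f) ?_
  have h : schrodingerCLM (-t) (schrodingerCLM t f) = f := by
    rw [schrodingerCLM_schrodingerCLM, neg_add_cancel, schrodingerCLM_zero]
  conv_lhs => rw [← h]
  exact norm_multiplier_le _

theorem inner_schrodingerCLM_left (t : ℝ) (f g : L2T) :
    inner ℂ (schrodingerCLM t f) g = inner ℂ f (schrodingerCLM (-t) g) := by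
  refine inner_multiplier_left (fun k => ?_) f g
  rw [← Complex.exp_conj]
  simp

theorem continuous_schrodingerCLM_apply (f : L2T) : Continuous fun t => schrodingerCLM t f := by
  refine continuous_iff_continuousAt.2 fun t₀ => tendsto_iff_norm_sub_tendsto_zero.2 ?_
  -- Dominated convergence in the Parseval sum: two unimodular symbols differ by at most 2, hence
  -- the majorant `4 |f̂(k)|²`.
  have hs := (hasSum_sq_norm_fourierCoeff f).summable.mul_left 4
  have hlim : Tendsto (fun t : ℝ => ∑' k : ℤ, ‖fourierCoeff
      (↑(schrodingerCLM t f - schrodingerCLM t₀ f) : Torus → ℂ) k‖ ^ 2) (𝓝 t₀)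
      (𝓝 (∑' _ : ℤ, (0 : ℝ))) := by
    refine tendsto_tsum_of_dominated_convergence hs (fun k => ?_)
      (Eventually.of_forall fun t k => ?_)
    · simp only [fourierCoeff_sub_L2T, fourierCoeff_schrodingerCLM]
      have hc : Continuous fun t : ℝ => ‖Complex.exp (-Complex.I * t * (k : ℂ) ^ 2) *
          fourierCoeff (f : Torus → ℂ) k - Complex.exp (-Complex.I * t₀ * (k : ℂ) ^ 2) *
          fourierCoeff (f : Torus → ℂ) k‖ ^ 2 := by fun_prop
      simpa using hc.tendsto t₀
    · simp only [fourierCoeff_sub_L2T, fourierCoeff_schrodingerCLM]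
      rw [← sub_mul, norm_mul, mul_pow, Real.norm_of_nonneg (by positivity)]
      gcongr
      have h2 := norm_sub_le (Complex.exp (-Complex.I * t * (k : ℂ) ^ 2))
        (Complex.exp (-Complex.I * t₀ * (k : ℂ) ^ 2))
      rw [norm_exp_neg_I_mul, norm_exp_neg_I_mul] at h2
      nlinarith [norm_nonneg (Complex.exp (-Complex.I * t * (k : ℂ) ^ 2) -
        Complex.exp (-Complex.I * t₀ * (k : ℂ) ^ 2))]
  simp only [(hasSum_sq_norm_fourierCoeff _).tsum_eq, tsum_zero] at hlim
  simpa [Function.comp_def] using (Real.continuous_sqrt.tendsto 0).comp hlim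

/-- Strong continuity upgrades to joint continuity because every operator of the group is an
isometry. -/
theorem continuous_schrodingerCLM {g : ℝ → ℝ} {u : ℝ → L2T} (hg : Continuous g)
    (hu : Continuous u) : Continuous fun t => schrodingerCLM (g t) (u t) := by
  refine continuous_iff_continuousAt.2 fun t₀ => tendsto_iff_norm_sub_tendsto_zero.2 ?_
  have h1 : Tendsto (fun t => ‖u t - u t₀‖) (𝓝 t₀) (𝓝 0) :=
    tendsto_iff_norm_sub_tendsto_zero.1 (hu.tendsto t₀)
  have h2 : Tendsto (fun t => ‖schrodingerCLM (g t) (u t₀) -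
      schrodingerCLM (g t₀) (u t₀)‖) (𝓝 t₀) (𝓝 0) :=
    tendsto_iff_norm_sub_tendsto_zero.1
      (((continuous_schrodingerCLM_apply (u t₀)).comp hg).tendsto t₀)
  refine squeeze_zero (fun _ => norm_nonneg _) (fun t => ?_) (by simpa using h1.add h2)
  have := norm_sub_le_norm_sub_add_norm_sub (schrodingerCLM (g t) (u t))
    (schrodingerCLM (g t) (u t₀)) (schrodingerCLM (g t₀) (u t₀))
  rwa [← map_sub, norm_schrodingerCLM] at this

end Schrodinger

/-! ### Heat convolution as a Fourier multiplier -/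

section Heat

theorem norm_exp_neg_mul_sq_le {ε : ℝ} (hε : 0 < ε) (k : ℤ) :
    ‖(Real.exp (-ε * (k : ℝ) ^ 2) : ℂ)‖ ≤ 1 := by
  rw [Complex.norm_real, Real.norm_of_nonneg (Real.exp_pos _).le, Real.exp_le_one_iff]
  nlinarith [sq_nonneg (k : ℝ)]

/-- The heat semigroup on `L²(𝕋)`, the Fourier multiplier with symbol `e^{-εk²}`. -/
def heatCLM {ε : ℝ} (hε : 0 < ε) : L2T →L[ℂ] L2T :=
  multiplier (fun k => (Real.exp (-ε * (k : ℝ) ^ 2) : ℂ)) (norm_exp_neg_mul_sq_le hε)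

/-- Poisson summation for the Gaussian, in the form of the functional equation between `evenKernel`
at `π / ε` and `cosKernel` at `ε / π`. -/
theorem hasSum_torusHeatKernel {ε : ℝ} (hε : 0 < ε) (x : Torus) :
    HasSum (fun n : ℤ => (Real.exp (-ε * (n : ℝ) ^ 2) : ℂ) * fourier n x)
      (2 * π * (torusHeatKernel ε x : ℂ)) := by
  induction x using QuotientAddGroup.induction_on with | H x => ?_
  have hπ := Real.pi_pos
  have heven : torusHeatKernel ε (x : Torus) = (2 * Real.sqrt (π * ε))⁻¹ *
      HurwitzZeta.evenKernel (((-(x / (2 * π)) : ℝ)) : UnitAddCircle) (π / ε) := by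
    have h := HurwitzZeta.hasSum_int_evenKernel (-(x / (2 * π))) (div_pos hπ hε)
    rw [← (h.mul_left (2 * Real.sqrt (π * ε))⁻¹).tsum_eq]
    change ∑' n : ℤ, heatKernel ε (x - 2 * π * n) = _
    refine tsum_congr fun n => ?_
    unfold heatKernel
    congr 2
    field_simp
    ring
  have hconst : 2 * π * torusHeatKernel ε (x : Torus) =
      HurwitzZeta.cosKernel ((x / (2 * π) : ℝ) : UnitAddCircle) (ε / π) := by
    rw [heven, HurwitzZeta.evenKernel_functional_equation, AddCircle.coe_neg,
      HurwitzZeta.cosKernel_neg, one_div_div, ← Real.sqrt_eq_rpow, Real.sqrt_div hπ.le,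
      Real.sqrt_mul hπ.le]
    have h1 := Real.sqrt_pos.2 hπ
    have h2 := Real.sqrt_pos.2 hε
    have h3 := Real.sq_sqrt hπ.le
    field_simp
    rw [h3]
  have h := HurwitzZeta.hasSum_int_cosKernel (x / (2 * π)) (div_pos hε hπ)
  have hcast : (2 * π * (torusHeatKernel ε (x : Torus) : ℂ)) =
      ((2 * π * torusHeatKernel ε (x : Torus) : ℝ) : ℂ) := by push_cast; ring
  change HasSum _ (2 * π * (torusHeatKernel ε (x : Torus) : ℂ))
  rw [hcast, hconst]
  refine h.congr_fun fun n => ?_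
  rw [fourier_coe_apply, mul_comm]
  have hπ' : (π : ℂ) ≠ 0 := by exact_mod_cast hπ.ne'
  congr 2
  · push_cast
    field_simp
  · congr 1
    field_simp

theorem summable_exp_neg_mul_sq {ε : ℝ} (hε : 0 < ε) :
    Summable fun n : ℤ => Real.exp (-ε * (n : ℝ) ^ 2) := by
  have h := (hasSum_torusHeatKernel hε 0).summable
  simp only [fourier_eval_zero, mul_one] at h
  exact Complex.summable_ofReal.1 h

theorem fourier_sub_apply (n : ℤ) (x y : Torus) :
    fourier n (x - y) = fourier n x * fourier (-n) y := by
  rw [fourier_apply, fourier_apply, fourier_apply, zsmul_sub, sub_eq_add_neg,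
    AddCircle.toCircle_add, Circle.coe_mul, neg_smul]

theorem hasSum_heatConv {ε : ℝ} (hε : 0 < ε) {f : Torus → ℂ}
    (hf : Integrable f AddCircle.haarAddCircle) (x : Torus) :
    HasSum (fun n : ℤ => (Real.exp (-ε * (n : ℝ) ^ 2) : ℂ) * fourierCoeff f n * fourier n x)
      (heatConv ε f x) := by
  have hnorm : ∀ n : ℤ, ∀ y : Torus, ‖fourier n y‖ = 1 := fun n y => by
    rw [fourier_apply, Circle.norm_coe]
  have hint : ∀ n : ℤ, Integrable (fun y => (Real.exp (-ε * (n : ℝ) ^ 2) : ℂ) * fourier n x *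
      (fourier (-n) y • f y)) AddCircle.haarAddCircle := fun n =>
    (hf.fourier_smul (-n)).const_mul _
  have h := hasSum_integral_of_summable_integral_norm hint (by
    refine ((summable_exp_neg_mul_sq hε).mul_right
      (∫ y, ‖f y‖ ∂AddCircle.haarAddCircle)).congr fun n => ?_
    rw [← integral_const_mul]
    refine integral_congr_ae (Eventually.of_forall fun y => ?_)
    simp only [norm_mul, norm_smul, hnorm, Complex.norm_real, mul_one, one_mul,
      Real.norm_of_nonneg (Real.exp_pos _).le])
  -- Convolution uses Lebesgue measure, which is `2π` times the normalised Haar measure; this factor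
  -- is the `2π` multiplying the kernel in `hasSum_torusHeatKernel`.
  have hval : heatConv ε f x = ∫ y, ∑' n : ℤ, (Real.exp (-ε * (n : ℝ) ^ 2) : ℂ) * fourier n x *
      (fourier (-n) y • f y) ∂AddCircle.haarAddCircle := by
    rw [heatConv, convolution_def, AddCircle.volume_eq_smul_haarAddCircle, integral_smul_measure,
      ENNReal.toReal_ofReal Real.two_pi_pos.le, ← integral_smul]
    refine integral_congr_ae (Eventually.of_forall fun y => ?_)
    have hk := (hasSum_torusHeatKernel hε (x - y)).mul_left (f y)
    simp only [ContinuousLinearMap.mul_apply', Complex.real_smul]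
    refine Eq.trans ?_ (hk.tsum_eq.symm.trans (tsum_congr fun n => ?_))
    · push_cast; ring
    · rw [fourier_sub_apply, smul_eq_mul]; ring
  rw [hval]
  refine h.congr_fun fun n => ?_
  rw [integral_const_mul, fourierCoeff]
  ring

theorem integrable_L2T (f : L2T) : Integrable (f : Torus → ℂ) AddCircle.haarAddCircle :=
  (Lp.memLp f).integrable (by norm_num)

theorem coeFn_toL2 {g : Torus → ℂ} (hg : Continuous g) :
    (toL2 g : Torus → ℂ) =ᵐ[AddCircle.haarAddCircle] g := by
  rw [toL2, dif_pos (memLp_of_continuous hg)]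
  exact MemLp.coeFn_toLp _

/-- The damped Fourier series converges uniformly. Its sum is the convolution when evaluated
pointwise and the multiplier when viewed in `L²`. -/
theorem toL2_heatConv {ε : ℝ} (hε : 0 < ε) (f : L2T) : toL2 (heatConv ε f) = heatCLM hε f := by
  have hsum : Summable fun n : ℤ => ((Real.exp (-ε * (n : ℝ) ^ 2) : ℂ) *
      fourierCoeff (f : Torus → ℂ) n) • (fourier n : C(Torus, ℂ)) := by
    refine Summable.of_norm_bounded ((summable_exp_neg_mul_sq hε).mul_right ‖f‖) fun n => ?_
    rw [norm_smul, fourier_norm, mul_one, norm_mul, Complex.norm_real,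
      Real.norm_of_nonneg (Real.exp_pos _).le]
    gcongr
    exact norm_fourierCoeff_le f n
  obtain ⟨g, hg⟩ := hsum
  have hgconv : ⇑g = heatConv ε f := by
    funext x
    have h1 := ContinuousMap.hasSum_apply hg x
    exact h1.unique (hasSum_heatConv hε (integrable_L2T f) x)
  have hL := hg.mapL (ContinuousMap.toLp (E := ℂ) 2 AddCircle.haarAddCircle ℂ)
  have hgA : ContinuousMap.toLp (E := ℂ) 2 AddCircle.haarAddCircle ℂ g = heatCLM hε f := by
    refine hL.unique ?_
    simp only [map_smul]
    exact hasSum_multiplier f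
  rw [← hgA, ← hgconv]
  refine Lp.ext ((coeFn_toL2 g.continuous).trans ?_)
  exact (ContinuousMap.coeFn_toLp AddCircle.haarAddCircle g).symm

theorem heatConv_congr_ae {ε : ℝ} {f g : Torus → ℂ} (h : f =ᵐ[AddCircle.haarAddCircle] g) :
    heatConv ε f = heatConv ε g := by
  funext x
  rw [heatConv, heatConv, convolution_def, convolution_def, AddCircle.volume_eq_smul_haarAddCircle,
    integral_smul_measure, integral_smul_measure]
  congr 1
  exact integral_congr_ae (h.mono fun y hy => by simp only [hy])

/-- The smoothing from `L²` to sup norm that makes the power nonlinearity locally Lipschitz on `L²`: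
each Fourier coefficient is at most the `L²` norm, and the symbol is summable. -/
theorem norm_heatConv_sub_le {ε : ℝ} (hε : 0 < ε) (f g : L2T) (x : Torus) :
    ‖heatConv ε f x - heatConv ε g x‖ ≤
      (∑' n : ℤ, Real.exp (-ε * (n : ℝ) ^ 2)) * ‖f - g‖ := by
  have h := (hasSum_heatConv hε (integrable_L2T f) x).sub
    (hasSum_heatConv hε (integrable_L2T g) x)
  rw [← h.tsum_eq, ← tsum_mul_right]
  refine tsum_of_norm_bounded ((summable_exp_neg_mul_sq hε).mul_right _).hasSum fun n => ?_
  rw [← sub_mul, ← mul_sub, ← fourierCoeff_sub_L2T, norm_mul, norm_mul, fourier_apply,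
    Circle.norm_coe, mul_one, Complex.norm_real, Real.norm_of_nonneg (Real.exp_pos _).le]
  gcongr
  exact norm_fourierCoeff_le _ n

end Heat

/-! ### Sobolev norms and heat smoothing -/

section Sobolev

theorem enorm_ft_sq (f : L2T) (k : ℤ) :
    ‖ft f k‖ₑ ^ 2 = ENNReal.ofReal (2 * π) * ‖fourierCoeff (f : Torus → ℂ) k‖ₑ ^ 2 := by
  have h : ‖((Real.sqrt (2 * π) : ℝ) : ℂ)‖ₑ = ENNReal.ofReal (Real.sqrt (2 * π)) := by
    rw [← ofReal_norm, Complex.norm_real, Real.norm_of_nonneg (Real.sqrt_nonneg _)]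
  rw [ft, enorm_mul, mul_pow, h, ← ENNReal.ofReal_pow (Real.sqrt_nonneg _),
    Real.sq_sqrt Real.two_pi_pos.le]

theorem enorm_sq_rpow_half (f : L2T) : (‖f‖ₑ ^ 2) ^ (1 / 2 : ℝ) = ‖f‖ₑ := by
  rw [← ENNReal.rpow_natCast, ← ENNReal.rpow_mul]
  norm_num

theorem enorm_le_sobolevNorm {s : ℝ} (hs : 0 ≤ s) (f : L2T) : ‖f‖ₑ ≤ sobolevNorm s f := by
  rw [← enorm_sq_rpow_half f, ← tsum_sq_enorm_fourierCoeff]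
  refine ENNReal.rpow_le_rpow (ENNReal.tsum_le_tsum fun k => ?_) (by norm_num)
  rw [enorm_ft_sq, ← mul_assoc]
  refine le_mul_of_one_le_left' (one_le_mul ?_ ?_)
  · rw [ENNReal.one_le_ofReal]
    exact Real.one_le_rpow (by nlinarith [sq_nonneg (k : ℝ)]) hs
  · rw [ENNReal.one_le_ofReal]
    linarith [Real.pi_gt_three]

theorem rpow_mul_exp_neg_le {ε s : ℝ} (hε : 0 < ε) (hs : 0 < s) {x : ℝ} (hx : 0 ≤ x) :
    (1 + x) ^ s * Real.exp (-ε * x) ≤ (s / ε) ^ s * Real.exp ε := by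
  -- This is `y ≤ e^y` at `y = ε (1 + x) / s`, scaled so that the `s`-th power produces exactly
  -- `e^{ε(1 + x)}`.
  have h1 : 1 + x ≤ s / ε * Real.exp (ε / s * (1 + x)) := by
    have h := Real.add_one_le_exp (ε / s * (1 + x))
    calc 1 + x = s / ε * (ε / s * (1 + x)) := by field_simp
      _ ≤ _ := by gcongr; linarith
  have h2 : (1 + x) ^ s ≤ (s / ε) ^ s * Real.exp (ε * (1 + x)) := by
    calc (1 + x) ^ s ≤ (s / ε * Real.exp (ε / s * (1 + x))) ^ s := by gcongr
      _ = _ := by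
        rw [Real.mul_rpow (by positivity) (Real.exp_pos _).le, ← Real.exp_mul]
        congr 2
        field_simp
  calc (1 + x) ^ s * Real.exp (-ε * x)
      ≤ (s / ε) ^ s * Real.exp (ε * (1 + x)) * Real.exp (-ε * x) := by gcongr
    _ = (s / ε) ^ s * Real.exp ε := by
      rw [mul_assoc, ← Real.exp_add]
      congr 2
      ring

/-- The heat semigroup maps `L²(𝕋)` boundedly to `H^s(𝕋)`. -/
theorem exists_sobolevNorm_heatCLM_le {ε s : ℝ} (hε : 0 < ε) (hs : 0 < s) :
    ∃ C : ℝ≥0, ∀ f : L2T, sobolevNorm s (heatCLM hε f) ≤ C * ‖f‖ₑ := by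
  -- The squared symbol is `e^{-2εk²}`, so the elementary bound is used with `2 * ε`; the factor
  -- `2π` is the square of the normalisation in `ft`.
  set B : ℝ := (s / (2 * ε)) ^ s * Real.exp (2 * ε) * (2 * π)
  have hB : 0 ≤ B := by positivity
  refine ⟨(Real.sqrt B).toNNReal, fun f => ?_⟩
  have hterm : ∀ k : ℤ, ENNReal.ofReal ((1 + (k : ℝ) ^ 2) ^ s) * ‖ft (heatCLM hε f) k‖ₑ ^ 2 ≤
      ENNReal.ofReal B * ‖fourierCoeff (f : Torus → ℂ) k‖ₑ ^ 2 := by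
    intro k
    have hk : ‖fourierCoeff (heatCLM hε f : Torus → ℂ) k‖ₑ ^ 2 =
        ENNReal.ofReal (Real.exp (-(2 * ε) * (k : ℝ) ^ 2)) *
          ‖fourierCoeff (f : Torus → ℂ) k‖ₑ ^ 2 := by
      rw [heatCLM, fourierCoeff_multiplier, enorm_mul, mul_pow, ← ofReal_norm (Complex.ofReal _),
        Complex.norm_real, Real.norm_of_nonneg (Real.exp_pos _).le,
        ← ENNReal.ofReal_pow (Real.exp_pos _).le, ← Real.exp_nat_mul]
      congr 3
      push_cast
      ring
    rw [enorm_ft_sq, hk, ← mul_assoc, ← mul_assoc, ← ENNReal.ofReal_mul (by positivity),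
      ← ENNReal.ofReal_mul (by positivity)]
    gcongr
    have := rpow_mul_exp_neg_le (ε := 2 * ε) (by positivity) hs (sq_nonneg (k : ℝ))
    have hπ := Real.two_pi_pos
    calc _ = (1 + (k : ℝ) ^ 2) ^ s * Real.exp (-(2 * ε) * (k : ℝ) ^ 2) * (2 * π) := by ring
      _ ≤ B := mul_le_mul_of_nonneg_right this hπ.le
  have hsqrt : ((Real.sqrt B).toNNReal : ℝ≥0∞) = ENNReal.ofReal B ^ (1 / 2 : ℝ) := by
    rw [ENNReal.ofReal_rpow_of_nonneg hB (by norm_num), ← Real.sqrt_eq_rpow,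
      ENNReal.ofReal]
  calc sobolevNorm s (heatCLM hε f)
      ≤ (∑' k : ℤ, ENNReal.ofReal B * ‖fourierCoeff (f : Torus → ℂ) k‖ₑ ^ 2) ^ (1 / 2 : ℝ) :=
        ENNReal.rpow_le_rpow (ENNReal.tsum_le_tsum hterm) (by norm_num)
    _ = _ := by
      rw [ENNReal.tsum_mul_left, tsum_sq_enorm_fourierCoeff,
        ENNReal.mul_rpow_of_nonneg _ _ (by norm_num), enorm_sq_rpow_half, hsqrt]

end Sobolev

/-! ### The smoothed power nonlinearity -/

section Power

/-- The map `z ↦ |z|^β z` is Lipschitz on bounded sets, for `β ∈ [0, 1]`. -/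
theorem norm_rpow_mul_sub_le {β R : ℝ} (hβ : β ∈ Icc (0 : ℝ) 1) {z w : ℂ} (hz : ‖z‖ ≤ R)
    (hw : ‖w‖ ≤ R) :
    ‖((‖z‖ ^ β : ℝ) : ℂ) * z - ((‖w‖ ^ β : ℝ) : ℂ) * w‖ ≤ 2 * R ^ β * ‖z - w‖ := by
  wlog hle : ‖w‖ ≤ ‖z‖ generalizing z w
  · rw [norm_sub_rev, norm_sub_rev z]
    exact this hw hz (le_of_not_ge hle)
  have hR : ‖z‖ ^ β ≤ R ^ β := Real.rpow_le_rpow (norm_nonneg _) hz hβ.1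
  have hmono : ‖w‖ ^ β ≤ ‖z‖ ^ β := Real.rpow_le_rpow (norm_nonneg _) hle hβ.1
  -- After division by `‖z‖ ^ β * ‖z‖` this reads `(1 - x^β) x ≤ 1 - x` with `x = ‖w‖ / ‖z‖ ≤ 1`. It
  -- follows from `x ≤ x^β`, which is where `β ≤ 1` enters.
  have key : (‖z‖ ^ β - ‖w‖ ^ β) * ‖w‖ ≤ ‖z‖ ^ β * (‖z‖ - ‖w‖) := by
    rcases (norm_nonneg z).eq_or_lt with h0 | h0
    · have hw0 : ‖w‖ = 0 := le_antisymm (h0 ▸ hle) (norm_nonneg _)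
      rw [hw0, ← h0]
      simp
    · set x := ‖w‖ / ‖z‖ with hx
      have hx0 : 0 ≤ x := by positivity
      have hx1 : x ≤ 1 := (div_le_one h0).2 hle
      have hwx : ‖w‖ = x * ‖z‖ := by rw [hx]; field_simp
      have hxβ : x ≤ x ^ β := by
        simpa using Real.rpow_le_rpow_of_exponent_ge_of_imp hx0 hx1 hβ.2 (by
          intro _ hβ0; norm_num at hβ0 )
      rw [hwx, Real.mul_rpow hx0 h0.le]
      have hp : 0 ≤ ‖z‖ ^ β * ‖z‖ := by positivity
      have : (1 - x ^ β) * x ≤ 1 - x := by nlinarith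
      nlinarith
  have hsplit : ((‖z‖ ^ β : ℝ) : ℂ) * z - ((‖w‖ ^ β : ℝ) : ℂ) * w =
      ((‖z‖ ^ β : ℝ) : ℂ) * (z - w) + ((‖z‖ ^ β - ‖w‖ ^ β : ℝ) : ℂ) * w := by
    push_cast; ring
  rw [hsplit]
  refine (norm_add_le _ _).trans ?_
  rw [norm_mul, norm_mul, Complex.norm_real, Complex.norm_real,
    Real.norm_of_nonneg (by positivity), Real.norm_of_nonneg (sub_nonneg.2 hmono)]
  have h1 : ‖z‖ - ‖w‖ ≤ ‖z - w‖ := norm_sub_norm_le z w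
  have h2 : 0 ≤ ‖z‖ ^ β := by positivity
  calc ‖z‖ ^ β * ‖z - w‖ + (‖z‖ ^ β - ‖w‖ ^ β) * ‖w‖
      ≤ ‖z‖ ^ β * ‖z - w‖ + ‖z‖ ^ β * ‖z - w‖ := by
        grw [key, h1]
    _ = 2 * ‖z‖ ^ β * ‖z - w‖ := by ring
    _ ≤ _ := by gcongr

/-- The class in `L²(𝕋)` of `|w ∗ φ_ε|^(α - 1) (w ∗ φ_ε)`. -/
def powerL2 (ε α : ℝ) (w : L2T) : L2T :=
  toL2 fun x => ((‖heatConv ε w x‖ ^ (α - 1) : ℝ) : ℂ) * heatConv ε w x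

variable {ε α : ℝ}

theorem coeFn_powerL2 (hε : 0 < ε) (hα : 1 ≤ α) (w : L2T) :
    (powerL2 ε α w : Torus → ℂ) =ᵐ[AddCircle.haarAddCircle]
      fun x => ((‖heatConv ε w x‖ ^ (α - 1) : ℝ) : ℂ) * heatConv ε w x := by
  have h := continuous_heatConv hε (integrable_L2T w)
  exact coeFn_toL2 ((Complex.continuous_ofReal.comp
    (h.norm.rpow_const fun _ => Or.inr (by linarith))).mul h)

theorem toL2_smoothedPower (hε : 0 < ε) (hα : 1 ≤ α) (w : L2T) :
    toL2 (smoothedPower ε α w) = heatCLM hε (powerL2 ε α w) := by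
  rw [← toL2_heatConv, heatConv_congr_ae (coeFn_powerL2 hε hα w)]
  rfl

theorem heatConv_zero_L2T (ε : ℝ) (x : Torus) : heatConv ε (0 : L2T) x = 0 := by
  have h : heatConv ε (0 : L2T) = heatConv ε (0 : Torus → ℂ) :=
    heatConv_congr_ae (Lp.coeFn_zero ℂ 2 AddCircle.haarAddCircle)
  rw [h, heatConv, zero_convolution]
  rfl

theorem powerL2_zero (hε : 0 < ε) (hα : 1 ≤ α) : powerL2 ε α 0 = 0 := by
  refine Lp.ext ((coeFn_powerL2 hε hα 0).trans ?_)
  filter_upwards [Lp.coeFn_zero ℂ 2 (AddCircle.haarAddCircle : Measure Torus)] with x hx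
  rw [hx, heatConv_zero_L2T ε, mul_zero]
  rfl

theorem exists_lipschitzOnWith_powerL2 (hε : 0 < ε) (hα : α ∈ Icc (1 : ℝ) 2) (R : ℝ) :
    ∃ K : ℝ≥0, LipschitzOnWith K (powerL2 ε α) (Metric.closedBall 0 R) := by
  set C : ℝ := ∑' n : ℤ, Real.exp (-ε * (n : ℝ) ^ 2)
  have hC : 0 ≤ C := tsum_nonneg fun _ => (Real.exp_pos _).le
  rcases lt_or_ge R 0 with hR | hR
  · exact ⟨0, by simp [Metric.closedBall_eq_empty.2 hR]⟩
  refine ⟨(2 * (C * R) ^ (α - 1) * C).toNNReal, LipschitzOnWith.of_dist_le_mul fun f hf g hg => ?_⟩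
  rw [mem_closedBall_zero_iff] at hf hg
  rw [dist_eq_norm, dist_eq_norm, Real.coe_toNNReal _ (by positivity)]
  have hsup : ∀ h : L2T, ‖h‖ ≤ R → ∀ x, ‖heatConv ε h x‖ ≤ C * R := fun h hh x => by
    have := norm_heatConv_sub_le hε h 0 x
    rw [heatConv_zero_L2T ε, sub_zero, sub_zero] at this
    exact this.trans (by gcongr)
  have hbound : ∀ᵐ x ∂(AddCircle.haarAddCircle : Measure Torus),
      ‖(powerL2 ε α f - powerL2 ε α g : L2T) x‖ ≤ 2 * (C * R) ^ (α - 1) * C * ‖f - g‖ := by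
    filter_upwards [Lp.coeFn_sub (powerL2 ε α f) (powerL2 ε α g), coeFn_powerL2 hε hα.1 f,
      coeFn_powerL2 hε hα.1 g] with x hx hxf hxg
    rw [hx, Pi.sub_apply, hxf, hxg]
    refine (norm_rpow_mul_sub_le ⟨by linarith [hα.1], by linarith [hα.2]⟩ (hsup f hf x)
      (hsup g hg x)).trans ?_
    rw [mul_assoc _ C]
    gcongr
    exact norm_heatConv_sub_le hε f g x
  -- The normalised Haar measure has mass one, so the pointwise bound is an `L²` bound with the same
  -- constant.
  have h := Lp.norm_le_of_ae_bound (by positivity) hbound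
  simpa [measureUnivNNReal] using h

/-- Moving the self-adjoint heat operator to the other factor leaves the integral of a real
function; this is the source of mass conservation. -/
theorem inner_heatCLM_powerL2_im (hε : 0 < ε) (hα : 1 ≤ α) (w : L2T) :
    (inner ℂ w (heatCLM hε (powerL2 ε α w))).im = 0 := by
  have hsymm : inner ℂ w (heatCLM hε (powerL2 ε α w)) =
      inner ℂ (heatCLM hε w) (powerL2 ε α w) :=
    (inner_multiplier_left (fun k => Complex.conj_ofReal _) _ _).symm
  have hreal : inner ℂ (heatCLM hε w) (powerL2 ε α w) =
      ((∫ x, ‖heatConv ε w x‖ ^ (α - 1) * ‖heatConv ε w x‖ ^ 2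
        ∂(AddCircle.haarAddCircle : Measure Torus) : ℝ) : ℂ) := by
    rw [L2.inner_def, ← integral_complex_ofReal]
    refine integral_congr_ae ?_
    have hA := coeFn_toL2 (continuous_heatConv hε (integrable_L2T w))
    rw [toL2_heatConv hε] at hA
    filter_upwards [hA, coeFn_powerL2 hε hα w] with x hx hxp
    rw [hx, hxp, RCLike.inner_apply, mul_assoc, Complex.mul_conj, Complex.normSq_eq_norm_sq]
    push_cast
    rfl
  rw [hsymm, hreal, Complex.ofReal_im]

end Power

/-! ### The equation as an ODE in the interaction picture -/

section VectorField

variable {ε α : ℝ}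

/-- The vector field of the equation in the interaction picture `u(t) = e^{-it∂ₓ²} w(t)`. -/
def interactionField (ε α σ : ℝ) (hε : 0 < ε) (t : ℝ) (u : L2T) : L2T :=
  ((σ : ℂ) * Complex.I) •
    schrodingerCLM (-t) (heatCLM hε (powerL2 ε α (schrodingerCLM t u)))

theorem continuous_powerL2 (hε : 0 < ε) (hα : α ∈ Icc (1 : ℝ) 2) :
    Continuous (powerL2 ε α) := by
  refine continuous_iff_continuousAt.2 fun w => ?_
  obtain ⟨K, hK⟩ := exists_lipschitzOnWith_powerL2 hε hα (‖w‖ + 1)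
  exact hK.continuousOn.continuousAt (Metric.closedBall_mem_nhds_of_mem (by simp))

theorem exists_lipschitzOnWith_interactionField (σ : ℝ) (hε : 0 < ε) (hα : α ∈ Icc (1 : ℝ) 2)
    (R : ℝ) : ∃ K : ℝ≥0, ∀ t,
      LipschitzOnWith K (interactionField ε α σ hε t) (Metric.closedBall 0 R) := by
  obtain ⟨K, hK⟩ := exists_lipschitzOnWith_powerL2 hε hα R
  refine ⟨‖σ‖₊ * K, fun t => LipschitzOnWith.of_dist_le_mul fun f hf g hg => ?_⟩
  have hmem : ∀ {h : L2T}, h ∈ Metric.closedBall 0 R →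
      schrodingerCLM t h ∈ Metric.closedBall 0 R := fun {h} hh => by
    rw [mem_closedBall_zero_iff] at hh ⊢
    rwa [norm_schrodingerCLM]
  have h := hK.dist_le_mul _ (hmem hf) _ (hmem hg)
  rw [dist_eq_norm, dist_eq_norm, ← map_sub, norm_schrodingerCLM] at h
  rw [dist_eq_norm, dist_eq_norm, interactionField, interactionField, ← smul_sub, ← map_sub,
    ← map_sub, norm_smul, norm_schrodingerCLM, norm_mul, Complex.norm_I, Complex.norm_real, mul_one,
    NNReal.coe_mul, coe_nnnorm, mul_assoc]
  gcongr
  exact (norm_multiplier_le _).trans h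

theorem interactionField_zero (σ : ℝ) (hε : 0 < ε) (hα : 1 ≤ α) (t : ℝ) :
    interactionField ε α σ hε t 0 = 0 := by
  simp [interactionField, powerL2_zero hε hα]

theorem continuous_interactionField (σ : ℝ) (hε : 0 < ε) (hα : α ∈ Icc (1 : ℝ) 2)
    {u : ℝ → L2T} (hu : Continuous u) :
    Continuous fun t => interactionField ε α σ hε t (u t) :=
  (continuous_schrodingerCLM continuous_neg ((heatCLM hε).continuous.comp
    ((continuous_powerL2 hε hα).comp (continuous_schrodingerCLM continuous_id hu)))).fun_const_smul _

theorem inner_interactionField_re (σ : ℝ) (hε : 0 < ε) (hα : 1 ≤ α) (t : ℝ) (u : L2T) :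
    (inner ℂ u (interactionField ε α σ hε t u)).re = 0 := by
  rw [interactionField, inner_smul_right, ← inner_schrodingerCLM_left, mul_assoc,
    Complex.re_ofReal_mul, Complex.I_mul_re, inner_heatCLM_powerL2_im hε hα]
  simp

end VectorField

/-! ### Mild solutions: trajectories, stability and smoothing -/

section MildSolution

variable {ε α σ : ℝ} {w₀ : L2T} {w : ℝ → L2T}

theorem ContinuousInSobolev.continuousOn {s : ℝ} (hs : 0 ≤ s) {J : Set ℝ}
    (h : ContinuousInSobolev s J w) : ContinuousOn w J := by
  intro t₀ ht₀
  refine tendsto_iff_edist_tendsto_0.2 ?_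
  refine tendsto_of_tendsto_of_tendsto_of_le_of_le tendsto_const_nhds (h.2 t₀ ht₀)
    (fun _ => zero_le) fun t => ?_
  rw [edist_eq_enorm_sub]
  exact enorm_le_sobolevNorm hs _

/-- On a time interval where it is continuous, a mild solution is a trajectory of the vector field
in the interaction picture. -/
theorem IsMildSolution.exists_trajectory (hε : 0 < ε) (hα : α ∈ Icc (1 : ℝ) 2) {b : ℝ}
    (hw : IsMildSolution ε α σ w₀ (uIcc 0 b) w) (hc : ContinuousOn w (uIcc 0 b)) :
    ∃ u : ℝ → L2T, u 0 = heatCLM hε w₀ ∧ (∀ t ∈ uIcc 0 b, w t = schrodingerCLM t (u t)) ∧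
      ∀ t ∈ uIcc 0 b, HasDerivAt u (interactionField ε α σ hε t (u t)) t := by
  -- Extending `w` by its endpoint values makes the integrand continuous on all of `ℝ`, so the
  -- primitive has two-sided derivatives even at the endpoints.
  set v : ℝ → L2T := fun t => w (projIcc (0 ⊓ b) (0 ⊔ b) inf_le_sup t) with hv_def
  have hv : Continuous v := hc.comp_continuous (continuous_subtype_val.comp continuous_projIcc)
    fun t => (projIcc (0 ⊓ b) (0 ⊔ b) inf_le_sup t).2
  have hvw : ∀ t ∈ uIcc 0 b, v t = w t := fun t ht => by
    simp only [hv_def, projIcc_of_mem inf_le_sup ht]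
  set G : ℝ → L2T := fun t => ((σ : ℂ) * Complex.I) •
    schrodingerCLM (-t) (heatCLM hε (powerL2 ε α (v t)))
  have hG : Continuous G :=
    (continuous_schrodingerCLM continuous_neg ((heatCLM hε).continuous.comp
      ((continuous_powerL2 hε hα).comp hv))).fun_const_smul _
  have hwt : ∀ t ∈ uIcc 0 b,
      w t = schrodingerCLM t (heatCLM hε w₀ + ∫ τ in (0 : ℝ)..t, G τ) := by
    intro t ht
    rw [hw t ht, schrodinger_eq, toL2_heatConv hε, map_add,
      ← ContinuousLinearMap.intervalIntegral_comp_comm _ (hG.intervalIntegrable _ _),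
      ← intervalIntegral.integral_smul]
    congr 1
    refine intervalIntegral.integral_congr fun τ hτ => ?_
    have hτ' : τ ∈ uIcc 0 b := uIcc_subset_uIcc_left ht hτ
    simp only [G]
    rw [schrodinger_eq, toL2_smoothedPower hε hα.1, hvw τ hτ', map_smul,
      schrodingerCLM_schrodingerCLM, sub_eq_add_neg]
  refine ⟨fun t => heatCLM hε w₀ + ∫ τ in (0 : ℝ)..t, G τ, by simp, hwt, fun t ht => ?_⟩
  have hd := (intervalIntegral.integral_hasDerivAt_right (hG.intervalIntegrable 0 t)
    (hG.stronglyMeasurableAtFilter _ _) hG.continuousAt).const_add (heatCLM hε w₀)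
  have hGt : G t = interactionField ε α σ hε t (heatCLM hε w₀ + ∫ τ in (0 : ℝ)..t, G τ) := by
    rw [interactionField, ← hwt t ht, ← hvw t ht]
  rwa [hGt] at hd

/-- Mild solutions depend on their data in a Lipschitz way in `L²(𝕋)`. -/
theorem IsMildSolution.norm_sub_le (hε : 0 < ε) (hα : α ∈ Icc (1 : ℝ) 2) {R : ℝ} {K : ℝ≥0}
    (hK : ∀ t, LipschitzOnWith K (interactionField ε α σ hε t) (Metric.closedBall 0 R)) {b : ℝ}
    {w₀' : L2T} {w' : ℝ → L2T} (hR : ‖w₀‖ ≤ R) (hR' : ‖w₀'‖ ≤ R)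
    (hw : IsMildSolution ε α σ w₀ (uIcc 0 b) w) (hc : ContinuousOn w (uIcc 0 b))
    (hw' : IsMildSolution ε α σ w₀' (uIcc 0 b) w') (hc' : ContinuousOn w' (uIcc 0 b)) :
    ‖w b‖ ≤ R ∧ ‖w' b‖ ≤ R ∧ ‖w b - w' b‖ ≤ ‖w₀ - w₀'‖ * Real.exp (K * |b|) := by
  obtain ⟨u, hu0, hwu, hu⟩ := hw.exists_trajectory hε hα hc
  obtain ⟨u', hu0', hwu', hu'⟩ := hw'.exists_trajectory hε hα hc'
  -- Mass conservation confines both trajectories to the ball on which the field is `K`-Lipschitz,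
  -- so Grönwall's inequality applies with no smallness of `b`.
  have hnorm : ∀ {v : ℝ → L2T} {v₀ : L2T}, v 0 = heatCLM hε v₀ → ‖v₀‖ ≤ R →
      (∀ t ∈ uIcc 0 b, HasDerivAt v (interactionField ε α σ hε t (v t)) t) →
      ∀ t ∈ uIcc 0 b, ‖v t‖ ≤ R := by
    intro v v₀ hv0 hv₀ hv t ht
    rw [norm_eq_of_inner_deriv_re_eq_zero (fun r hr => hv r (uIcc_subset_uIcc_left ht hr))
      fun r _ => inner_interactionField_re σ hε hα.1 r (v r), hv0]
    exact (norm_multiplier_le _).trans hv₀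
  have hub := hnorm hu0 hR hu
  have hub' := hnorm hu0' hR' hu'
  rw [hwu b right_mem_uIcc, hwu' b right_mem_uIcc, ← map_sub]
  simp only [norm_schrodingerCLM]
  refine ⟨hub b right_mem_uIcc, hub' b right_mem_uIcc, ?_⟩
  refine (norm_sub_le_of_trajectories hK hu hu' (fun t ht => by simpa using hub t ht)
    (fun t ht => by simpa using hub' t ht)).trans ?_
  rw [hu0, hu0', ← map_sub]
  gcongr
  exact norm_multiplier_le _

theorem exists_isMildSolution (hε : 0 < ε) (hα : α ∈ Icc (1 : ℝ) 2) (σ : ℝ) (w₀ : L2T) :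
    ∃ w : ℝ → L2T, Continuous w ∧ IsMildSolution ε α σ w₀ univ w := by
  obtain ⟨u, hu0, hu⟩ := exists_trajectory_of_orthogonal
    (exists_lipschitzOnWith_interactionField σ hε hα) (interactionField_zero σ hε hα.1)
    (fun x => continuous_interactionField σ hε hα continuous_const)
    (inner_interactionField_re σ hε hα.1) (heatCLM hε w₀)
  have huc : Continuous u := continuous_iff_continuousAt.2 fun t => (hu t).continuousAt
  have hF := continuous_interactionField σ hε hα huc
  refine ⟨fun t => schrodingerCLM t (u t), continuous_schrodingerCLM continuous_id huc,
    fun t _ => ?_⟩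
  have hint := intervalIntegral.integral_eq_sub_of_hasDerivAt (fun r _ => hu r)
    (hF.intervalIntegrable 0 t)
  have hut : u t = heatCLM hε w₀ +
      ∫ τ in (0 : ℝ)..t, interactionField ε α σ hε τ (u τ) := by
    rw [hint, hu0]
    abel
  beta_reduce
  rw [schrodinger_eq, toL2_heatConv hε, ← intervalIntegral.integral_smul, hut, map_add,
    ← ContinuousLinearMap.intervalIntegral_comp_comm _ (hF.intervalIntegrable _ _)]
  congr 1
  refine intervalIntegral.integral_congr fun τ _ => ?_
  rw [schrodinger_eq, toL2_smoothedPower hε hα.1, interactionField, map_smul,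
    schrodingerCLM_schrodingerCLM, sub_eq_add_neg]

/-- A profile whose image under the heat semigroup is the mild solution `w` with datum `w₀`. -/
def preheat (ε α σ : ℝ) (w₀ : L2T) (w : ℝ → L2T) (t : ℝ) : L2T :=
  schrodingerCLM t (w₀ + ((σ : ℂ) * Complex.I) •
    ∫ τ in (0 : ℝ)..t, schrodingerCLM (-τ) (powerL2 ε α (w τ)))

theorem continuous_schrodingerCLM_powerL2 (hε : 0 < ε) (hα : α ∈ Icc (1 : ℝ) 2)
    (hc : Continuous w) : Continuous fun τ => schrodingerCLM (-τ) (powerL2 ε α (w τ)) :=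
  continuous_schrodingerCLM continuous_neg ((continuous_powerL2 hε hα).comp hc)

theorem continuous_preheat (hε : 0 < ε) (hα : α ∈ Icc (1 : ℝ) 2) (hc : Continuous w) :
    Continuous (preheat ε α σ w₀ w) := by
  have h := continuous_schrodingerCLM_powerL2 hε hα hc
  exact continuous_schrodingerCLM continuous_id (continuous_const.add
    ((intervalIntegral.continuous_primitive (fun a b => h.intervalIntegrable a b) 0).fun_const_smul _))

/-- The heat operator commutes with the Schrödinger group and with the integral, so it factors out
of the whole Duhamel formula. -/
theorem IsMildSolution.eq_heatCLM_preheat (hε : 0 < ε) (hα : α ∈ Icc (1 : ℝ) 2)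
    (hw : IsMildSolution ε α σ w₀ univ w) (hc : Continuous w) (t : ℝ) :
    w t = heatCLM hε (preheat ε α σ w₀ w t) := by
  have h := continuous_schrodingerCLM_powerL2 hε hα hc
  have hcomm : ∀ (r : ℝ) (f : L2T),
      heatCLM hε (schrodingerCLM r f) = schrodingerCLM r (heatCLM hε f) :=
    fun r f => multiplier_comm f
  have hint : (heatCLM hε) (∫ τ in (0 : ℝ)..t, schrodingerCLM (-τ) (powerL2 ε α (w τ))) =
      ∫ τ in (0 : ℝ)..t, schrodingerCLM (-τ) (heatCLM hε (powerL2 ε α (w τ))) := by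
    rw [← ContinuousLinearMap.intervalIntegral_comp_comm _ (h.intervalIntegrable _ _)]
    exact intervalIntegral.integral_congr fun τ _ => hcomm _ _
  have h' : Continuous fun τ => schrodingerCLM (-τ) (heatCLM hε (powerL2 ε α (w τ))) :=
    continuous_schrodingerCLM continuous_neg
      ((heatCLM hε).continuous.comp ((continuous_powerL2 hε hα).comp hc))
  rw [preheat, hcomm, map_add, map_smul, hint, map_add, map_smul,
    ← ContinuousLinearMap.intervalIntegral_comp_comm _ (h'.intervalIntegrable _ _), hw t trivial,
    schrodinger_eq, toL2_heatConv hε]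
  congr 2
  refine intervalIntegral.integral_congr fun τ _ => ?_
  rw [schrodinger_eq, toL2_smoothedPower hε hα.1, schrodingerCLM_schrodingerCLM, sub_eq_add_neg]

theorem IsMildSolution.continuousInSobolev {s : ℝ} (hε : 0 < ε) (hα : α ∈ Icc (1 : ℝ) 2)
    (hs : 0 < s) (hw : IsMildSolution ε α σ w₀ univ w) (hc : Continuous w) :
    ContinuousInSobolev s univ w := by
  obtain ⟨C, hC⟩ := exists_sobolevNorm_heatCLM_le hε hs
  have hy := continuous_preheat (σ := σ) (w₀ := w₀) hε hα hc
  have heq := hw.eq_heatCLM_preheat hε hα hc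
  refine ⟨fun t _ => ?_, fun t₀ _ => ?_⟩
  · rw [heq t, MemSobolev]
    exact (hC _).trans_lt (ENNReal.mul_lt_top ENNReal.coe_lt_top enorm_lt_top)
  · have hlim : Tendsto (fun t => C * ‖preheat ε α σ w₀ w t - preheat ε α σ w₀ w t₀‖ₑ)
        (𝓝[univ] t₀) (𝓝 0) := by
      have h1 := tendsto_iff_edist_tendsto_0.1 (hy.tendsto t₀)
      simp only [edist_eq_enorm_sub] at h1
      rw [nhdsWithin_univ]
      simpa using ENNReal.Tendsto.const_mul h1 (Or.inr (ENNReal.coe_ne_top (r := C)))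
    refine tendsto_of_tendsto_of_tendsto_of_le_of_le tendsto_const_nhds hlim
      (fun _ => zero_le) fun t => ?_
    beta_reduce
    rw [heq t, heq t₀, ← map_sub]
    exact hC _

theorem norm_preheat_sub_le (hε : 0 < ε) (hα : α ∈ Icc (1 : ℝ) 2) {w₀' : L2T} {w' : ℝ → L2T}
    (hc : Continuous w) (hc' : Continuous w') {D t : ℝ}
    (hD : ∀ τ ∈ uIcc 0 t, ‖powerL2 ε α (w τ) - powerL2 ε α (w' τ)‖ ≤ D) :
    ‖preheat ε α σ w₀ w t - preheat ε α σ w₀' w' t‖ ≤ ‖w₀ - w₀'‖ + |σ| * (D * |t|) := by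
  have h := continuous_schrodingerCLM_powerL2 hε hα hc
  have h' := continuous_schrodingerCLM_powerL2 hε hα hc'
  rw [preheat, preheat, ← map_sub, norm_schrodingerCLM, add_sub_add_comm, ← smul_sub,
    ← intervalIntegral.integral_sub (h.intervalIntegrable _ _) (h'.intervalIntegrable _ _)]
  refine (norm_add_le _ _).trans ?_
  rw [norm_smul, norm_mul, Complex.norm_I, mul_one, Complex.norm_real, Real.norm_eq_abs]
  gcongr
  have hle := intervalIntegral.norm_integral_le_of_norm_le_const (a := 0) (b := t) (C := D)
    (f := fun τ => schrodingerCLM (-τ) (powerL2 ε α (w τ)) -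
      schrodingerCLM (-τ) (powerL2 ε α (w' τ))) fun τ hτ => by
    rw [← map_sub, norm_schrodingerCLM]
    exact hD τ (uIoc_subset_uIcc hτ)
  simpa using hle

end MildSolution

/-! ### Global well-posedness -/

theorem IsMildSolution.mono {ε α σ : ℝ} {w₀ : L2T} {w : ℝ → L2T} {I J : Set ℝ}
    (hw : IsMildSolution ε α σ w₀ J w) (hIJ : I ⊆ J) : IsMildSolution ε α σ w₀ I w :=
  fun t ht => hw t (hIJ ht)

theorem globallyWellPosed {ε α σ s : ℝ} (hε : 0 < ε) (hα : α ∈ Icc (1 : ℝ) 2) (hs : 0 < s) :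
    GloballyWellPosed ε α σ s where
  exists_solution w₀ _ := by
    obtain ⟨w, hc, hw⟩ := exists_isMildSolution hε hα σ w₀
    exact ⟨w, hw.continuousInSobolev hε hα hs hc, hw⟩
  unique w₀ _ J hJ h0 w w' hw hw' b hb := by
    have hsub : uIcc 0 b ⊆ J := hJ.uIcc_subset h0 hb
    obtain ⟨K, hK⟩ := exists_lipschitzOnWith_interactionField σ hε hα ‖w₀‖
    have h := (IsMildSolution.norm_sub_le hε hα hK le_rfl le_rfl
      (hw.2.mono hsub) ((hw.1.continuousOn hs.le).mono hsub)
      (hw'.2.mono hsub) ((hw'.1.continuousOn hs.le).mono hsub)).2.2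
    rw [sub_self, norm_zero, zero_mul] at h
    exact sub_eq_zero.1 (norm_le_zero_iff.1 h)
  continuous_dependence w₀ _ w hw T hT η hη := by
    obtain ⟨C, hC⟩ := exists_sobolevNorm_heatCLM_le hε hs
    obtain ⟨K, hK⟩ := exists_lipschitzOnWith_interactionField σ hε hα (‖w₀‖ + 1)
    obtain ⟨L, hL⟩ := exists_lipschitzOnWith_powerL2 hε hα (‖w₀‖ + 1)
    -- `M` bounds the Lipschitz constant of datum to profile in `L²`: 1 for the datum itself, and in
    -- the Duhamel term `L` for the power, `e^{KT}` for the growth of the difference and `T` for the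
    -- length of integration.
    set M : ℝ≥0 := 1 + ‖σ‖₊ * (L * (Real.exp (K * T)).toNNReal * T.toNNReal) with hM_def
    obtain ⟨δ, hδ, hδη⟩ : ∃ δ : ℝ≥0∞, 0 < δ ∧ (C * M : ℝ≥0) * δ < η := by
      have hlim : Tendsto (fun δ : ℝ≥0∞ => (C * M : ℝ≥0) * δ) (𝓝[>] 0) (𝓝 0) := by
        have := ENNReal.Tendsto.const_mul (a := ((C * M : ℝ≥0) : ℝ≥0∞)) (b := 0)
          (tendsto_id (α := ℝ≥0∞)) (Or.inr ENNReal.coe_ne_top)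
        simp only [mul_zero, id] at this
        exact this.mono_left nhdsWithin_le_nhds
      exact ((hlim.eventually_lt_const hη).and self_mem_nhdsWithin).exists.imp
        fun δ h => ⟨h.2, h.1⟩
    -- The cap at 1 keeps the perturbed datum in the ball of radius `‖w₀‖ + 1` for which `K` and `L`
    -- were chosen.
    refine ⟨min δ 1, lt_min hδ one_pos, fun w₀' _ hw₀' w' hw' t ht => ?_⟩
    have hdist : ‖w₀' - w₀‖ₑ < min δ 1 := (enorm_le_sobolevNorm hs.le _).trans_lt hw₀'
    have hR' : ‖w₀'‖ ≤ ‖w₀‖ + 1 := by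
      have h1 : ‖w₀' - w₀‖ < 1 := by
        have := hdist.trans_le (min_le_right _ _)
        rwa [← ofReal_norm, ENNReal.ofReal_lt_one] at this
      linarith [norm_le_norm_add_norm_sub' w₀' w₀]
    have hc := continuousOn_univ.1 (hw.1.continuousOn hs.le)
    have hc' := continuousOn_univ.1 (hw'.1.continuousOn hs.le)
    have hbT : |t| ≤ T := abs_le.2 ht
    have hD : ∀ τ ∈ uIcc 0 t, ‖powerL2 ε α (w' τ) - powerL2 ε α (w τ)‖ ≤
        L * (‖w₀' - w₀‖ * Real.exp (K * T)) := by
      intro τ hτ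
      have hτT : |τ| ≤ T := by
        have : |τ| ≤ |t| := by simpa using abs_sub_left_of_mem_uIcc hτ
        exact this.trans hbT
      obtain ⟨h1, h2, h3⟩ := IsMildSolution.norm_sub_le hε hα hK hR' (by linarith)
        (hw'.2.mono (subset_univ (uIcc 0 τ))) hc'.continuousOn
        (hw.2.mono (subset_univ (uIcc 0 τ))) hc.continuousOn
      have h4 := hL.dist_le_mul (w' τ) (by simpa using h1) (w τ) (by simpa using h2)
      rw [dist_eq_norm, dist_eq_norm] at h4
      refine h4.trans ?_
      gcongr
      exact h3.trans (by gcongr)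
    have hpre : ‖preheat ε α σ w₀' w' t - preheat ε α σ w₀ w t‖ ≤ M * ‖w₀' - w₀‖ := by
      refine (norm_preheat_sub_le hε hα hc' hc hD).trans ?_
      rw [hM_def]
      push_cast
      rw [Real.coe_toNNReal _ (Real.exp_pos _).le, Real.coe_toNNReal _ hT.le, Real.norm_eq_abs]
      calc ‖w₀' - w₀‖ + |σ| * (L * (‖w₀' - w₀‖ * Real.exp (K * T)) * |t|)
          ≤ ‖w₀' - w₀‖ + |σ| * (L * (‖w₀' - w₀‖ * Real.exp (K * T)) * T) := by gcongr
        _ = _ := by ring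
    have hpre' : ‖preheat ε α σ w₀' w' t - preheat ε α σ w₀ w t‖ₑ ≤ M * ‖w₀' - w₀‖ₑ := by
      rw [← ofReal_norm, ← ofReal_norm (w₀' - w₀), ← ENNReal.ofReal_coe_nnreal,
        ← ENNReal.ofReal_mul M.coe_nonneg]
      exact ENNReal.ofReal_le_ofReal hpre
    rw [hw'.2.eq_heatCLM_preheat hε hα hc' t, hw.2.eq_heatCLM_preheat hε hα hc t, ← map_sub]
    calc _ ≤ C * (M * ‖w₀' - w₀‖ₑ) := (hC _).trans (by gcongr)
      _ ≤ C * (M * δ) := by gcongr; exact (hdist.trans_le (min_le_left _ _)).le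
      _ = (C * M : ℝ≥0) * δ := by rw [ENNReal.coe_mul, mul_assoc]
      _ < η := hδη

end TorusNLS

end

theorem theoremA (ε α σ s : ℝ) (hε : 0 < ε) (hα : α ∈ Set.Icc (1 : ℝ) 2)
    (hσ : σ = 1 ∨ σ = -1) (hs : 1 ≤ s) :
    TorusNLS.GloballyWellPosed ε α σ s :=
  TorusNLS.globallyWellPosed hε hα (by linarith)
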